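/- For a nondegenerate closed triangle $K\subset\mathbb R^2$ let $h_K:=\operatorname{diam}K$. Here $|v|_{0,U}$ denotes the $L^2(U)$ norm, $H^1(U)$ is the Sobolev space of functions in $L^2(U)$ whose distributional gradient is in $L^2(U)^2$, $|v|_{1,U}:=|\nabla v|_{0,U}$, and $H^1_0(U)$ is the closure of $C_c^\infty(U)$ in $H^1(U)$. (Functions in $H^1(K)$ are functions in $H^1$ of the interior of $K$.) There is a constant $C_2^{(1)}>0$, independent of $K$, such that for every nondegenerate triangle $K\subset\mathbb R^2$ $$\sup\Bigl\{\tfrac{|v|_{0,K}}{|v|_{1,K}} : 0\ne v\in H^1(K),\ \int_K v\,\mathrm d\mathbf x=0\Bigr\}\le C_2^{(1)}h_K .$$ For every such constant $C_2^{(1)}$ the following holds. Let $\Omega\subset\mathbb R^2$ be a bounded polygonal domain (a nonempty bounded connected open set whose boundary is a finite union of line segments), and let $\mathcal T_h$ be a proper triangulation of $\Omega$, that is, a finite set of nondegenerate closed triangles with $\overline\Omega=\bigcup_{K\in\mathcal T_h}K$ such that any two different $K_1,K_2\in\mathcal T_h$ are disjoint or intersect exactly in a common vertex or exactly in a common edge.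 Put $h:=\max_{K\in\mathcal T_h}h_K$, and for $f\in L^2(\Omega)$ let $\pi_\Omega^0f$ be the piecewise constant function that is equal to $\frac1{|K|}\int_Kf\,\mathrm d\mathbf x$ on each $K\in\mathcal T_h$ (almost everywhere). Then $$\|f-\pi_\Omega^0f\|_{-1,\Omega}\le C_2^{(1)}\,h\,|f|_{0,\Omega}\qquad\text{for all } f\in L^2(\Omega),$$ where $\displaystyle\|u\|_{-1,\Omega}:=\sup_{0\ne\phi\in H^1_0(\Omega)}\frac{\int_\Omega u\,\phi\,\mathrm d\mathbf x}{\|\nabla\phi\|_{0,\Omega}}$ is the norm of $H^{-1}(\Omega)$, the dual of $H^1_0(\Omega)$ normed by $\|\nabla\phi\|_{0,\Omega}$. -/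

import Mathlib

open MeasureTheory
open scoped ENNReal ContDiff

noncomputable section

/-- The Euclidean plane. -/
abbrev Plane : Type := EuclideanSpace ℝ (Fin 2)

/-! ### Lebesgue and Sobolev spaces on open sets of the plane

Functions on `U` are represented by functions on the whole plane; only their restriction to `U`
enters the definitions. -/

/-- `v ∈ L²(U)`, for scalar functions and for vector fields. -/
def MemL2 {F : Type*} [NormedAddCommGroup F] (U : Set Plane) (v : Plane → F) : Prop :=
  MemLp v 2 (volume.restrict U)

/-- The norm of `L²(U)`, for scalar functions and for vector fields. -/
def normL2 {F : Type*} [NormedAddCommGroup F] (U : Set Plane) (v : Plane → F) : ℝ≥0∞ :=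
  eLpNorm v 2 (volume.restrict U)

/-- `ψ ∈ C_c^∞(U)`. -/
def IsTestFunction (U : Set Plane) (ψ : Plane → ℝ) : Prop :=
  ContDiff ℝ ∞ ψ ∧ HasCompactSupport ψ ∧ tsupport ψ ⊆ U

/-- `g` is the gradient of `v` on `U` in the sense of distributions. -/
def HasWeakGradient (U : Set Plane) (v : Plane → ℝ) (g : Plane → Plane) : Prop :=
  ∀ ψ : Plane → ℝ, IsTestFunction U ψ → ∀ i : Fin 2,
    ∫ x in U, v x * fderiv ℝ ψ x (EuclideanSpace.single i 1) = - ∫ x in U, g x i * ψ x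

/-- `v ∈ H¹(U)` with weak gradient `∇v = g` (which is unique up to null sets). In particular
`|v|_{1,U} = normL2 U g`. -/
def MemH1 (U : Set Plane) (v : Plane → ℝ) (g : Plane → Plane) : Prop :=
  MemL2 U v ∧ MemL2 U g ∧ HasWeakGradient U v g

/-- `φ ∈ H¹₀(U)`, the closure of `C_c^∞(U)` in `H¹(U)`, with weak gradient `∇φ = g`. -/
def MemH10 (U : Set Plane) (φ : Plane → ℝ) (g : Plane → Plane) : Prop :=
  MemH1 U φ g ∧
    ∀ ε : ℝ≥0∞, 0 < ε → ∃ ψ : Plane → ℝ, IsTestFunction U ψ ∧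
      normL2 U (fun x => φ x - ψ x) < ε ∧ normL2 U (fun x => g x - gradient ψ x) < ε

/-- The `H⁻¹(U)` norm of the functional `φ ↦ (u, φ)_U`: the supremum of `(u, φ)_U / ‖∇φ‖_{0,U}`
over `φ ∈ H¹₀(U)`. The quotient `0 / 0` at `φ = 0` is `0`; and negative values of the quotient may
be replaced by `0`, since `φ` can be replaced by `-φ`. -/
def normHneg1 (U : Set Plane) (u : Plane → ℝ) : ℝ≥0∞ :=
  ⨆ (φ : Plane → ℝ) (g : Plane → Plane) (_ : MemH10 U φ g),
    ENNReal.ofReal (∫ x in U, u x * φ x) / normL2 U g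

/-! ### Triangles and triangulations -/

/-- The closed (nondegenerate) triangle with the given vertices, as a set of points. -/
def closedTriangle (K : Affine.Triangle ℝ Plane) : Set Plane :=
  convexHull ℝ (Set.range K.points)

/-- `e` is an edge of the triangle `K`. -/
def IsEdge (K : Affine.Triangle ℝ Plane) (e : Set Plane) : Prop :=
  ∃ i j : Fin 3, i ≠ j ∧ e = segment ℝ (K.points i) (K.points j)

/-- A bounded polygonal domain: a bounded connected open set whose boundary consists of finitely
many line segments. -/
def IsPolygonalDomain (Ω : Set Plane) : Prop :=
  IsOpen Ω ∧ IsConnected Ω ∧ Bornology.IsBounded Ω ∧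
    ∃ S : Finset (Plane × Plane), frontier Ω = ⋃ p ∈ S, segment ℝ p.1 p.2

/-- A proper (face-to-face) triangulation of `Ω`. Different labellings of the same triangle cannot
both occur, because of the second condition. -/
def IsProperTriangulation (Ω : Set Plane) (T : Finset (Affine.Triangle ℝ Plane)) : Prop :=
  closure Ω = ⋃ K ∈ T, closedTriangle K ∧
  ∀ K₁ ∈ T, ∀ K₂ ∈ T, K₁ ≠ K₂ →
    closedTriangle K₁ ∩ closedTriangle K₂ = ∅ ∨
    (∃ i j : Fin 3, K₁.points i = K₂.points j ∧
      closedTriangle K₁ ∩ closedTriangle K₂ = {K₁.points i}) ∨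
    ∃ e : Set Plane, IsEdge K₁ e ∧ IsEdge K₂ e ∧ closedTriangle K₁ ∩ closedTriangle K₂ = e

/-- `h_K`, the diameter of a triangle. -/
def triangleDiam (K : Affine.Triangle ℝ Plane) : ℝ≥0∞ :=
  Metric.ediam (closedTriangle K)

/-- The fineness `h`, the maximum of the diameters of the triangles. -/
def meshSize (T : Finset (Affine.Triangle ℝ Plane)) : ℝ≥0∞ :=
  T.sup triangleDiam

/-- `π_Ω⁰ f`: on each triangle, the mean value of `f` over this triangle (and `0` on the edges,
which form a null set). -/
def piecewiseMean (T : Finset (Affine.Triangle ℝ Plane)) (f : Plane → ℝ) : Plane → ℝ :=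
  fun x => ∑ K ∈ T,
    (interior (closedTriangle K)).indicator (fun _ => ⨍ y in closedTriangle K, f y) x

/-! ### The constant -/

/-- The supremum of `|v|_{0,K} / |v|_{1,K}` over the `v ∈ H¹(K)` with `∫_K v = 0`, in `[0, ∞]`
(where `0 / 0 = 0`). -/
def meanZeroQuotient (K : Affine.Triangle ℝ Plane) : ℝ≥0∞ :=
  ⨆ (v : Plane → ℝ) (g : Plane → Plane) (_ : MemH1 (interior (closedTriangle K)) v g)
    (_ : ∫ x in interior (closedTriangle K), v x = 0),
    normL2 (interior (closedTriangle K)) v / normL2 (interior (closedTriangle K)) g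

/-- `C` is an admissible constant in the Poincaré--Wirtinger inequality on triangles, uniformly
with respect to the triangle. -/
def IsTriangleConstant (C : ℝ) : Prop :=
  0 < C ∧ ∀ K : Affine.Triangle ℝ Plane, meanZeroQuotient K ≤ ENNReal.ofReal C * triangleDiam K

end

/-!
For `φ ∈ H¹₀(Ω)`, subtraction of the piecewise mean value is symmetric in `L²(Ω)`, so that
`∫ (f - π f) φ = ∫ f (φ - π φ)`, and the Cauchy--Schwarz inequality leaves `|φ - π φ|` to be
estimated. On each triangle `K` the function `φ - π φ` has mean zero and gradient `∇φ`, whence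
`|φ - π φ|_K ≤ C h_K |∇φ|_K`; the squares of these bounds sum up to `(C h |∇φ|_Ω)²`, because the
interiors of the triangles fill `Ω` up to a null set. The domain may have slits that cross a
triangle, so `φ ∈ H¹(K)` is not a matter of restriction; it holds because `φ` is a limit of test
functions that are smooth on the whole plane (`MemH10.memH1_of_ae_le`).

That an admissible `C` exists is a Poincaré inequality for convex sets. If `U` is convex and
`v ∈ H¹(U)`, then `|v(· + w) - v| ≤ |w| |∇v|` in `L²(U ∩ (U - w))`
(`MemH1.normL2_translate_sub_le`). No approximation of `v` by smooth functions is needed: pair `v`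
with translates `η(· - t w)` of a test function, differentiate in `t`, and use duality
(`normL2_le_of_forall_isTestFunction`). Integration over `w ∈ U - U` gives, for `v` of mean zero,
`|U| |v|² ≤ ∫∫ |v(y) - v(x)|² dy dx ≤ |U - U| (diam U)² |∇v|²` (`MemH1.poincare_of_convex`). For a
triangle `|K - K| ≤ 9 |K|`, since `K - K` lies in a translate of `3 K`; so `C = 3` is admissible,
whatever the shape of the triangle.
-/

open scoped Pointwise

/-! ### Square-integrable functions -/

lemma eLpNorm_two_sq {α F : Type*} [MeasurableSpace α] [NormedAddCommGroup F] (μ : Measure α)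
    (u : α → F) : eLpNorm u 2 μ ^ 2 = ∫⁻ x, ‖u x‖ₑ ^ 2 ∂μ := by
  have h := eLpNorm_nnreal_pow_eq_lintegral (μ := μ) (f := u) (p := 2) (by norm_num)
  simpa using h

lemma lintegral_enorm_mul_le {α : Type*} [MeasurableSpace α] {μ : Measure α} {u v : α → ℝ}
    (hu : AEStronglyMeasurable u μ) (hv : AEStronglyMeasurable v μ) :
    ∫⁻ x, ‖u x * v x‖ₑ ∂μ ≤ eLpNorm u 2 μ * eLpNorm v 2 μ := by
  have h := eLpNorm_smul_le_mul_eLpNorm (p := 2) (q := 2) (r := 1) hv hu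
  rw [eLpNorm_one_eq_lintegral_enorm] at h
  simpa using h

lemma enorm_integral_mul_le {α : Type*} [MeasurableSpace α] {μ : Measure α} {u v : α → ℝ}
    (hu : AEStronglyMeasurable u μ) (hv : AEStronglyMeasurable v μ) :
    ‖∫ x, u x * v x ∂μ‖ₑ ≤ eLpNorm u 2 μ * eLpNorm v 2 μ :=
  (enorm_integral_le_lintegral_enorm _).trans (lintegral_enorm_mul_le hu hv)

lemma integrable_mul_of_memLp {α : Type*} [MeasurableSpace α] {μ : Measure α} {u v : α → ℝ}
    (hu : MemLp u 2 μ) (hv : MemLp v 2 μ) : Integrable (fun x => u x * v x) μ :=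
  hu.integrable_mul hv

lemma enorm_integral_mul_self {α : Type*} [MeasurableSpace α] {μ : Measure α} {u : α → ℝ}
    (hu : MemLp u 2 μ) : ‖∫ x, u x * u x ∂μ‖ₑ = eLpNorm u 2 μ ^ 2 := by
  have h0 : 0 ≤ ∫ x, u x * u x ∂μ := integral_nonneg fun x => mul_self_nonneg _
  rw [Real.enorm_eq_ofReal h0, ofReal_integral_eq_lintegral_ofReal (integrable_mul_of_memLp hu hu)
    (Filter.Eventually.of_forall fun x => mul_self_nonneg _), eLpNorm_two_sq]
  refine lintegral_congr fun x => ?_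
  rw [← Real.enorm_eq_ofReal (mul_self_nonneg _), enorm_mul, sq]

/-- Division by `a`, including the case `a = 0`. -/
lemma ENNReal.le_of_sq_le_mul {a b : ℝ≥0∞} (ha : a ≠ ⊤) (h : a ^ 2 ≤ b * a) : a ≤ b := by
  rcases eq_or_ne a 0 with rfl | h0
  · exact zero_le
  · rw [sq] at h
    exact (ENNReal.mul_le_mul_iff_left h0 ha).1 h

/-- Among all functions that differ from `u` by a constant, a function `u` of mean zero has the
smallest norm in `L²`, since it is orthogonal to the constants. -/
lemma eLpNorm_le_eLpNorm_sub_const {α : Type*} [MeasurableSpace α] {μ : Measure α}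
    [IsFiniteMeasure μ] {u : α → ℝ} (hu : MemLp u 2 μ) (h0 : ∫ x, u x ∂μ = 0) (c : ℝ) :
    eLpNorm u 2 μ ≤ eLpNorm (fun x => u x - c) 2 μ := by
  refine ENNReal.le_of_sq_le_mul hu.eLpNorm_ne_top ?_
  have hc : MemLp (fun x => u x - c) 2 μ := hu.sub (memLp_const c)
  have h : ∫ x, u x * u x ∂μ = ∫ x, (u x - c) * u x ∂μ := by
    have : ∀ x, (u x - c) * u x = u x * u x - c * u x := fun x => by ring
    simp_rw [this]
    rw [integral_sub (integrable_mul_of_memLp hu hu) ((hu.integrable (by norm_num)).const_mul c),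
      integral_const_mul, h0, mul_zero, sub_zero]
  rw [← enorm_integral_mul_self hu, h]
  exact enorm_integral_mul_le hc.1 hu.1

/-! ### Test functions -/

/-- A smooth cut-off function that equals `1` on a compact subset `L` of the open set `W`. -/
lemma exists_isTestFunction_eq_one {W L : Set Plane} (hW : IsOpen W) (hL : IsCompact L)
    (hLW : L ⊆ W) : ∃ χ : Plane → ℝ, IsTestFunction W χ ∧ (∀ x ∈ L, χ x = 1) ∧
      ∀ x, χ x ∈ Set.Icc (0 : ℝ) 1 := by
  obtain ⟨L', hL', hLL', hL'W⟩ := exists_compact_between hL hW hLW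
  obtain ⟨χ, h1, h0, h01⟩ := exists_contMDiffMap_one_nhds_of_subset_interior
    (n := ⊤) (modelWithCornersSelf ℝ Plane) hL.isClosed hLL'
  have hsupp : tsupport χ ⊆ L' := by
    refine closure_minimal (fun x hx => ?_) hL'.isClosed
    by_contra hxL
    exact hx (h0 x hxL)
  refine ⟨χ, ⟨?_, hL'.of_isClosed_subset (isClosed_tsupport _) hsupp, hsupp.trans hL'W⟩,
    fun x hx => h1.self_of_nhdsSet x hx, h01⟩
  exact χ.contMDiff.contDiff

lemma IsTestFunction.memLp {W : Set Plane} {η : Plane → ℝ} (h : IsTestFunction W η)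
    {p : ℝ≥0∞} (μ : Measure Plane) [IsFiniteMeasureOnCompacts μ] : MemLp η p μ :=
  h.1.continuous.memLp_of_hasCompactSupport h.2.1

lemma IsTestFunction.eq_zero {W : Set Plane} {η : Plane → ℝ} (h : IsTestFunction W η)
    {x : Plane} (hx : x ∉ W) : η x = 0 := by
  by_contra h0
  exact hx (h.2.2 (subset_tsupport _ h0))

lemma IsTestFunction.memLp_fderiv {W : Set Plane} {η : Plane → ℝ} (h : IsTestFunction W η)
    {p : ℝ≥0∞} (μ : Measure Plane) [IsFiniteMeasureOnCompacts μ] (w : Plane) :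
    MemLp (fun x => fderiv ℝ η x w) p μ := by
  have hc : Continuous (fun x => fderiv ℝ η x w) :=
    (h.1.continuous_fderiv (by simp)).clm_apply continuous_const
  exact hc.memLp_of_hasCompactSupport (h.2.1.fderiv_apply ℝ w)

/-- Functions of `L²(ℝ²)` that vanish outside a compact subset of `W` are limits of test functions
on `W`: multiply smooth approximations by a cut-off function. -/
lemma exists_isTestFunction_eLpNorm_sub_le {W L : Set Plane} (hW : IsOpen W) (hL : IsCompact L)
    (hLW : L ⊆ W) {u : Plane → ℝ} (hu : MemLp u 2 volume) (h0 : ∀ x ∉ L, u x = 0) {ε : ℝ}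
    (hε : 0 < ε) :
    ∃ η, IsTestFunction W η ∧ eLpNorm (u - η) 2 volume ≤ ENNReal.ofReal ε := by
  obtain ⟨χ, hχ, hχ1, hχ01⟩ := exists_isTestFunction_eq_one hW hL hLW
  obtain ⟨f, -, hf, hfε⟩ := hu.exist_eLpNorm_sub_le (by norm_num) (by norm_num) hε
  refine ⟨fun x => χ x * f x, ⟨hχ.1.mul hf, hχ.2.1.mul_right,
    (tsupport_mul_subset_left).trans hχ.2.2⟩, le_trans (eLpNorm_mono fun x => ?_) hfε⟩
  -- Off `L` the target `u` vanishes, so the cut-off only decreases the error.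
  by_cases hx : x ∈ L
  · simp [hχ1 x hx]
  · simp only [Pi.sub_apply, h0 x hx, zero_sub, norm_neg, norm_mul]
    rw [Real.norm_of_nonneg (hχ01 x).1]
    exact mul_le_of_le_one_left (norm_nonneg _) (hχ01 x).2

lemma IsOpen.exists_isCompact_iUnion_eq {W : Set Plane} (hW : IsOpen W) :
    ∃ L : ℕ → Set Plane, (∀ n, IsCompact (L n)) ∧ (∀ n, L n ⊆ W) ∧ ⋃ n, L n = W ∧ Monotone L := by
  obtain ⟨F, hF, hFW, hU, hmono⟩ := hW.exists_iUnion_isClosed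
  refine ⟨fun n => F n ∩ Metric.closedBall 0 n,
    fun n => (isCompact_closedBall _ _).inter_left (hF n),
    fun n => Set.inter_subset_left.trans (hFW n), ?_, fun m n hmn => Set.inter_subset_inter
      (hmono hmn) (Metric.closedBall_subset_closedBall (by exact_mod_cast hmn))⟩
  refine subset_antisymm (Set.iUnion_subset fun n => Set.inter_subset_left.trans (hFW n)) ?_
  intro x hx
  rw [← hU] at hx
  obtain ⟨m, hm⟩ := Set.mem_iUnion.1 hx
  obtain ⟨n, hn⟩ := exists_nat_ge ‖x‖
  refine Set.mem_iUnion.2 ⟨max m n, hmono (le_max_left _ _) hm, ?_⟩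
  rw [mem_closedBall_zero_iff]
  exact hn.trans (by exact_mod_cast le_max_right m n)

/-- Duality: the norm of `L²(W)` is determined by the pairing with test functions. -/
lemma normL2_le_of_forall_isTestFunction {W : Set Plane} (hW : IsOpen W) {u : Plane → ℝ}
    (hu : MemL2 W u) {M : ℝ≥0∞}
    (h : ∀ η, IsTestFunction W η → ‖∫ x in W, u x * η x‖ₑ ≤ M * normL2 W η) :
    normL2 W u ≤ M := by
  -- On a compact set `L`, test functions approximate `u` itself; testing with them bounds `|u|²`.
  have key : ∀ L : Set Plane, IsCompact L → L ⊆ W → normL2 L u ≤ M := by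
    intro L hL hLW
    have huL : MemLp u 2 (volume.restrict L) :=
      hu.mono_measure (Measure.restrict_mono hLW le_rfl)
    have hind : MemLp (L.indicator u) 2 volume :=
      (memLp_indicator_iff_restrict hL.measurableSet).2 huL
    have hindN : eLpNorm (L.indicator u) 2 volume = normL2 L u :=
      eLpNorm_indicator_eq_eLpNorm_restrict hL.measurableSet
    have hfin : normL2 L u ≠ ⊤ := huL.eLpNorm_ne_top
    rcases eq_or_ne M ⊤ with rfl | hM
    · exact le_top
    refine ENNReal.le_of_sq_le_mul hfin ?_
    have hε : ∀ ε : ℝ, 0 < ε → normL2 L u ^ 2 ≤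
        M * (normL2 L u + ENNReal.ofReal ε) + normL2 W u * ENNReal.ofReal ε := by
      intro ε hε
      obtain ⟨η, hη, hηε⟩ := exists_isTestFunction_eLpNorm_sub_le hW hL hLW hind
        (fun x hx => Set.indicator_of_notMem hx u) hε
      have hηL2 : MemLp η 2 (volume.restrict W) := hη.memLp _
      have hindW : MemLp (L.indicator u) 2 (volume.restrict W) := hind.restrict W
      have e1 : ∫ x in L, u x * u x = ∫ x in W, u x * L.indicator u x := by
        rw [← integral_indicator hL.measurableSet, setIntegral_eq_integral_of_forall_compl_eq_zero]
        · congr 1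
          ext x
          by_cases hx : x ∈ L <;> simp [hx]
        · intro x hx
          simp [Set.indicator_of_notMem (fun h => hx (hLW h))]
      have e2 : ∫ x in W, u x * L.indicator u x =
          (∫ x in W, u x * η x) + ∫ x in W, u x * (L.indicator u - η) x := by
        rw [← integral_add (integrable_mul_of_memLp hu hηL2)
          (integrable_mul_of_memLp hu (hindW.sub hηL2))]
        congr 1
        ext x
        simp only [Pi.sub_apply]
        ring
      have e3 : normL2 W η ≤ normL2 L u + ENNReal.ofReal ε := by
        calc normL2 W η ≤ eLpNorm η 2 volume := eLpNorm_mono_measure _ Measure.restrict_le_self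
          _ = eLpNorm (L.indicator u - (L.indicator u - η)) 2 volume := by rw [sub_sub_cancel]
          _ ≤ eLpNorm (L.indicator u) 2 volume + eLpNorm (L.indicator u - η) 2 volume :=
            eLpNorm_sub_le hind.1 (hind.sub (hη.memLp _)).1 (by norm_num)
          _ ≤ normL2 L u + ENNReal.ofReal ε := by rw [hindN]; gcongr
      have e4 : ‖∫ x in L, u x * u x‖ₑ = normL2 L u ^ 2 := enorm_integral_mul_self huL
      rw [← e4, e1, e2]
      refine (enorm_add_le _ _).trans (add_le_add ((h η hη).trans (by gcongr)) ?_)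
      refine (enorm_integral_mul_le hu.1 (hindW.sub hηL2).1).trans ?_
      exact mul_le_mul_right ((eLpNorm_mono_measure _ Measure.restrict_le_self).trans hηε) _
    have hlim : Filter.Tendsto (fun ε : ℝ =>
        M * (normL2 L u + ENNReal.ofReal ε) + normL2 W u * ENNReal.ofReal ε)
        (nhdsWithin 0 (Set.Ioi 0)) (nhds (M * (normL2 L u + ENNReal.ofReal 0) +
          normL2 W u * ENNReal.ofReal 0)) := by
      have h0 : Filter.Tendsto (fun ε : ℝ => ENNReal.ofReal ε) (nhdsWithin 0 (Set.Ioi 0))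
          (nhds (ENNReal.ofReal 0)) :=
        (ENNReal.continuous_ofReal.tendsto 0).mono_left nhdsWithin_le_nhds
      exact (ENNReal.Tendsto.const_mul (tendsto_const_nhds.add h0) (Or.inr hM)).add
        (ENNReal.Tendsto.const_mul h0 (Or.inr hu.eLpNorm_ne_top))
    refine (ge_of_tendsto hlim ?_).trans (by simp)
    filter_upwards [self_mem_nhdsWithin] with ε hε0 using hε ε hε0
  obtain ⟨L, hLc, hLW, hLU, hLm⟩ := hW.exists_isCompact_iUnion_eq
  rw [← ENNReal.pow_le_pow_left_iff two_ne_zero, normL2, eLpNorm_two_sq, ← hLU,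
    setLIntegral_iUnion_of_directed _ hLm.directed_le]
  refine iSup_le fun n => ?_
  rw [← eLpNorm_two_sq]
  exact pow_le_pow_left' (key _ (hLc n) (hLW n)) 2

/-! ### Difference quotients of functions in `H¹` -/

lemma fderiv_apply_eq_sum (ψ : Plane → ℝ) (x w : Plane) :
    fderiv ℝ ψ x w = ∑ i, w i * fderiv ℝ ψ x (EuclideanSpace.single i 1) := by
  conv_lhs => rw [← (EuclideanSpace.basisFun (Fin 2) ℝ).sum_repr w]
  simp

lemma MemL2.apply {U : Set Plane} {g : Plane → Plane} (hg : MemL2 U g) (i : Fin 2) :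
    MemL2 U (fun x => g x i) := by
  refine MemLp.mono hg ?_ (Filter.Eventually.of_forall fun x => PiLp.norm_apply_le (g x) i)
  exact (EuclideanSpace.proj (𝕜 := ℝ) i).continuous.comp_aestronglyMeasurable hg.1

lemma MemL2.inner_const {U : Set Plane} {g : Plane → Plane} (hg : MemL2 U g) (w : Plane) :
    MemL2 U (fun x => inner ℝ (g x) w) :=
  MemLp.inner_const hg w

/-- The defining identity of the weak gradient, for the derivative in an arbitrary direction. -/
lemma MemH1.integral_mul_fderiv {U : Set Plane} {v : Plane → ℝ} {g : Plane → Plane}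
    (h : MemH1 U v g) {ψ : Plane → ℝ} (hψ : IsTestFunction U ψ) (w : Plane) :
    ∫ x in U, v x * fderiv ℝ ψ x w = - ∫ x in U, inner ℝ (g x) w * ψ x := by
  have e1 : ∀ x, v x * fderiv ℝ ψ x w =
      ∑ i, w i * (v x * fderiv ℝ ψ x (EuclideanSpace.single i 1)) := fun x => by
    rw [fderiv_apply_eq_sum, Finset.mul_sum]
    exact Finset.sum_congr rfl fun i _ => by ring
  have e2 : ∀ x, inner ℝ (g x) w * ψ x = ∑ i, w i * (g x i * ψ x) := fun x => by
    rw [PiLp.inner_apply, Finset.sum_mul]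
    exact Finset.sum_congr rfl fun i _ => by simp; ring
  simp_rw [e1, e2]
  rw [integral_finsetSum, integral_finsetSum, ← Finset.sum_neg_distrib]
  · refine Finset.sum_congr rfl fun i _ => ?_
    rw [integral_const_mul, integral_const_mul, h.2.2 ψ hψ i, mul_neg]
  · exact fun i _ => (integrable_mul_of_memLp (h.2.1.apply i) (hψ.memLp _)).const_mul _
  · exact fun i _ => (integrable_mul_of_memLp h.1 (hψ.memLp_fderiv _ _)).const_mul _

lemma IsTestFunction.comp_sub {U W : Set Plane} {η : Plane → ℝ} (h : IsTestFunction W η)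
    (w : Plane) (hw : ∀ x ∈ W, x + w ∈ U) : IsTestFunction U (fun x => η (x - w)) := by
  have hsupp : tsupport (fun x => η (x - w)) = (Homeomorph.subRight w) ⁻¹' tsupport η :=
    tsupport_comp_eq_preimage η (Homeomorph.subRight w)
  refine ⟨h.1.comp (contDiff_id.sub contDiff_const),
    h.2.1.comp_homeomorph (Homeomorph.subRight w), ?_⟩
  rw [hsupp]
  intro x hx
  have := hw _ (h.2.2 hx)
  simpa using this

lemma eLpNorm_comp_sub_right {η : Plane → ℝ} (hη : Continuous η) (w : Plane) (p : ℝ≥0∞) :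
    eLpNorm (fun x => η (x - w)) p volume = eLpNorm η p volume :=
  eLpNorm_comp_measurePreserving hη.aestronglyMeasurable (measurePreserving_sub_right volume w)

lemma norm_integral_inner_mul_le {U : Set Plane} {g : Plane → Plane} (hg : MemL2 U g)
    {η : Plane → ℝ} (hη : MemLp η 2 volume) (w : Plane) :
    ‖∫ x in U, inner ℝ (g x) w * η x‖ ≤
      (‖w‖ₑ * normL2 U g * eLpNorm η 2 volume).toReal := by
  have h1 : normL2 U (fun x => (inner ℝ (g x) w : ℝ)) ≤ ‖w‖ₑ * normL2 U g := by
    have := eLpNorm_le_nnreal_smul_eLpNorm_of_ae_le_mul (c := ‖w‖₊)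
      (f := fun x => (inner ℝ (g x) w : ℝ)) (g := g) (μ := volume.restrict U)
      (Filter.Eventually.of_forall fun x => by
        rw [mul_comm]; exact nnnorm_inner_le_nnnorm (𝕜 := ℝ) (g x) w) 2
    rwa [ENNReal.smul_def] at this
  have h2 : ‖∫ x in U, inner ℝ (g x) w * η x‖ₑ ≤ ‖w‖ₑ * normL2 U g * eLpNorm η 2 volume := by
    refine (enorm_integral_mul_le (hg.inner_const w).1 hη.1.restrict).trans ?_
    exact mul_le_mul' h1 (eLpNorm_mono_measure _ Measure.restrict_le_self)
  have h3 : ‖w‖ₑ * normL2 U g * eLpNorm η 2 volume ≠ ⊤ :=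
    ENNReal.mul_ne_top (ENNReal.mul_ne_top enorm_ne_top hg.eLpNorm_ne_top) hη.eLpNorm_ne_top
  rw [← toReal_enorm]
  exact ENNReal.toReal_mono h3 h2

/-- The pairing of `v` with a difference of a test function. Along the segment from `0` to `w`, the
pairing `t ↦ ∫ v(x) η(x - t w) dx` has the derivative `∫ (∇v(x) · w) η(x - t w) dx`, because the
translates of `η` remain test functions on the convex set `U`. -/
lemma MemH1.norm_integral_mul_sub_le {U : Set Plane} (hU : Convex ℝ U)
    (hUb : Bornology.IsBounded U) {v : Plane → ℝ} {g : Plane → Plane} (h : MemH1 U v g)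
    {w : Plane} {η : Plane → ℝ} (hη : IsTestFunction (U ∩ (fun x => x + w) ⁻¹' U) η) :
    ‖(∫ x in U, v x * η (x - w)) - ∫ x in U, v x * η x‖ ≤
      (‖w‖ₑ * normL2 U g * eLpNorm η 2 volume).toReal := by
  have hfin : IsFiniteMeasure (volume.restrict U) :=
    isFiniteMeasure_restrict.2 hUb.measure_lt_top.ne
  have hvint : Integrable v (volume.restrict U) := h.1.integrable (by norm_num)
  -- Convexity enters here: `x` and `x + w` in `U` give `x + t w` in `U`.
  have htrans : ∀ t ∈ Set.Icc (0 : ℝ) 1, IsTestFunction U (fun x => η (x - t • w)) := by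
    refine fun t ht => hη.comp_sub _ fun x hx => ?_
    have := hU.add_smul_sub_mem hx.1 hx.2 ht
    simpa using this
  have hη' : Continuous (fderiv ℝ η) := hη.1.continuous_fderiv (by simp)
  obtain ⟨C, hC⟩ := (hη.2.1.fderiv ℝ).exists_bound_of_continuous hη'
  have hline : ∀ x : Plane, ∀ t : ℝ,
      HasDerivAt (fun t : ℝ => η (x - t • w)) (fderiv ℝ η (x - t • w) (-w)) t := by
    intro x t
    have h1 : HasFDerivAt η (fderiv ℝ η (x - t • w)) (x - t • w) :=
      (hη.1.differentiable (by simp) _).hasFDerivAt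
    have h2 : HasDerivAt (fun t : ℝ => x - t • w) (-w) t := by
      simpa using ((hasDerivAt_id t).smul_const w).const_sub x
    exact h1.comp_hasDerivAt t h2
  have hderiv : ∀ t : ℝ, HasDerivAt (fun t : ℝ => ∫ x in U, v x * η (x - t • w))
      (∫ x in U, v x * fderiv ℝ η (x - t • w) (-w)) t := by
    intro t
    obtain ⟨B, hB⟩ := hη.2.1.exists_bound_of_continuous hη.1.continuous
    refine (hasDerivAt_integral_of_dominated_loc_of_deriv_le
      (F := fun (t : ℝ) x => v x * η (x - t • w))
      (F' := fun (t : ℝ) x => v x * fderiv ℝ η (x - t • w) (-w))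
      (bound := fun x => ‖v x‖ * (C * ‖w‖)) Filter.univ_mem ?_ ?_ ?_ ?_ ?_ ?_).2
    · refine Filter.Eventually.of_forall fun s => h.1.1.mul ?_
      exact (hη.1.continuous.comp (continuous_id.sub continuous_const)).aestronglyMeasurable
    · refine hvint.mul_bdd (c := B) ?_ (Filter.Eventually.of_forall fun x => hB _)
      exact (hη.1.continuous.comp (continuous_id.sub continuous_const)).aestronglyMeasurable
    · refine h.1.1.mul (Continuous.aestronglyMeasurable ?_)
      exact (hη'.comp (continuous_id.sub continuous_const)).clm_apply continuous_const
    · refine Filter.Eventually.of_forall fun x s _ => ?_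
      rw [norm_mul]
      gcongr
      refine (ContinuousLinearMap.le_opNorm _ _).trans ?_
      rw [norm_neg]
      exact mul_le_mul_of_nonneg_right (hC _) (norm_nonneg _)
    · exact hvint.norm.mul_const _
    · exact Filter.Eventually.of_forall fun x s _ => (hline x s).const_mul _
  have hbound : ∀ t ∈ Set.Ico (0 : ℝ) 1, ‖∫ x in U, v x * fderiv ℝ η (x - t • w) (-w)‖ ≤
      (‖w‖ₑ * normL2 U g * eLpNorm η 2 volume).toReal := by
    intro t ht
    have ht' := htrans t ⟨ht.1, ht.2.le⟩
    have e := h.integral_mul_fderiv ht' (-w)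
    simp_rw [fderiv_comp_sub] at e
    rw [e, norm_neg]
    have := norm_integral_inner_mul_le h.2.1 (ht'.memLp volume) (-w)
    rwa [enorm_neg, eLpNorm_comp_sub_right hη.1.continuous] at this
  have := norm_image_sub_le_of_norm_deriv_le_segment_01'
    (fun t _ => (hderiv t).hasDerivWithinAt) hbound
  simpa using this

/-- Functions in `H¹(U)`, for a convex set `U`, are Lipschitz continuous with respect to
translations in the norm of `L²`. -/
lemma MemH1.normL2_translate_sub_le {U : Set Plane} (hUo : IsOpen U) (hU : Convex ℝ U)
    (hUb : Bornology.IsBounded U) {v : Plane → ℝ} {g : Plane → Plane} (h : MemH1 U v g)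
    (w : Plane) :
    normL2 (U ∩ (fun x => x + w) ⁻¹' U) (fun x => v (x + w) - v x) ≤ ‖w‖ₑ * normL2 U g := by
  set W := U ∩ (fun x => x + w) ⁻¹' U with hW
  have hWo : IsOpen W := hUo.inter (hUo.preimage (continuous_add_const w))
  have hv : MemL2 W v := h.1.mono_measure (Measure.restrict_mono Set.inter_subset_left le_rfl)
  have hvw : MemL2 W (fun x => v (x + w)) := by
    have h1 : MemLp (U.indicator v) 2 volume :=
      (memLp_indicator_iff_restrict hUo.measurableSet).2 h.1
    have h2 := (h1.comp_measurePreserving (measurePreserving_add_right volume w)).restrict W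
    refine h2.ae_eq ?_
    filter_upwards [ae_restrict_mem hWo.measurableSet] with x hx
    exact Set.indicator_of_mem (show x + w ∈ U from hx.2) v
  refine normL2_le_of_forall_isTestFunction (u := fun x => v (x + w) - v x) hWo
    (hvw.sub hv) fun η hη => ?_
  have hηW : MemLp η 2 (volume.restrict W) := hη.memLp _
  -- As `η` vanishes off `W`, the translation moves over to `η` and `W` may be replaced by `U`.
  have e1 : ∫ x in W, v (x + w) * η x = ∫ x in U, v x * η (x - w) := by
    rw [setIntegral_eq_integral_of_forall_compl_eq_zero
      (fun x hx => by rw [hη.eq_zero hx, mul_zero]),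
      setIntegral_eq_integral_of_forall_compl_eq_zero (fun x hx => ?_)]
    · rw [← integral_add_right_eq_self (fun x => v x * η (x - w)) w]
      simp
    · rw [hη.eq_zero fun hx' => hx ?_, mul_zero]
      simpa using hx'.2
  have e2 : ∫ x in W, v x * η x = ∫ x in U, v x * η x := by
    rw [setIntegral_eq_integral_of_forall_compl_eq_zero
      (fun x hx => by rw [hη.eq_zero hx, mul_zero]),
      setIntegral_eq_integral_of_forall_compl_eq_zero (fun x hx => ?_)]
    rw [hη.eq_zero fun hx' => hx hx'.1, mul_zero]
  have e3 : normL2 W η = eLpNorm η 2 volume :=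
    eLpNorm_restrict_eq_of_support_subset ((subset_tsupport _).trans hη.2.2)
  have hfin : ‖w‖ₑ * normL2 U g * eLpNorm η 2 volume ≠ ⊤ :=
    ENNReal.mul_ne_top (ENNReal.mul_ne_top enorm_ne_top h.2.1.eLpNorm_ne_top)
      (hη.memLp volume).eLpNorm_ne_top
  simp_rw [sub_mul]
  rw [integral_sub (integrable_mul_of_memLp hvw hηW) (integrable_mul_of_memLp hv hηW), e1, e2, e3,
    ← ofReal_norm]
  exact ENNReal.ofReal_le_of_le_toReal (h.norm_integral_mul_sub_le hU hUb hη)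

/-! ### The Poincaré inequality on convex sets -/

lemma MemH1.congr {U : Set Plane} {v v' : Plane → ℝ} {g : Plane → Plane} (h : MemH1 U v g)
    (hv : v =ᵐ[volume.restrict U] v') : MemH1 U v' g := by
  refine ⟨h.1.ae_eq hv, h.2.1, fun ψ hψ i => ?_⟩
  rw [← h.2.2 ψ hψ i]
  refine integral_congr_ae ?_
  filter_upwards [hv] with x hx
  rw [hx]

/-- A double integral over `U × U`, in the coordinates `x` and `w = y - x`. -/
lemma setLIntegral_setLIntegral_eq_translate {U : Set Plane} (hU : MeasurableSet U)
    {F : Plane → Plane → ℝ≥0∞} (hF : Measurable (Function.uncurry F)) :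
    ∫⁻ x in U, ∫⁻ y in U, F x y =
      ∫⁻ w, ∫⁻ x in U ∩ (fun x => x + w) ⁻¹' U, F x (x + w) := by
  have hW : ∀ w : Plane, MeasurableSet (U ∩ (fun x => x + w) ⁻¹' U) := fun w =>
    hU.inter (measurable_add_const w hU)
  have hH : Measurable (fun p : Plane × Plane =>
      (U ×ˢ U).indicator (Function.uncurry F) (p.1, p.1 + p.2)) :=
    (hF.indicator (hU.prod hU)).comp (measurable_fst.prodMk (measurable_fst.add measurable_snd))
  calc ∫⁻ x in U, ∫⁻ y in U, F x y
      = ∫⁻ x, ∫⁻ y, (U ×ˢ U).indicator (Function.uncurry F) (x, y) := by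
        rw [← lintegral_indicator hU]
        refine lintegral_congr fun x => ?_
        by_cases hx : x ∈ U
        · rw [Set.indicator_of_mem hx, ← lintegral_indicator hU]
          refine lintegral_congr fun y => ?_
          by_cases hy : y ∈ U <;> simp [hx, hy]
        · simp [hx]
    _ = ∫⁻ x, ∫⁻ w, (U ×ˢ U).indicator (Function.uncurry F) (x, x + w) := by
        refine lintegral_congr fun x => ?_
        rw [← lintegral_add_left_eq_self _ x]
    _ = ∫⁻ w, ∫⁻ x, (U ×ˢ U).indicator (Function.uncurry F) (x, x + w) :=
        lintegral_lintegral_swap hH.aemeasurable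
    _ = ∫⁻ w, ∫⁻ x in U ∩ (fun x => x + w) ⁻¹' U, F x (x + w) := by
        refine lintegral_congr fun w => ?_
        rw [← lintegral_indicator (hW w)]
        refine lintegral_congr fun x => ?_
        by_cases hx : x ∈ U <;> by_cases hy : x + w ∈ U <;> simp [hx, hy]

/-- The Poincaré inequality on a bounded convex open set. The double integral of
`|v(x) - v(y)|²` bounds the left-hand side since `v` has mean zero; sorted by `w = y - x`, which
ranges over `U - U`, it is controlled by the translation estimate. -/
theorem MemH1.poincare_of_convex {U : Set Plane} (hUo : IsOpen U) (hU : Convex ℝ U)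
    (hUb : Bornology.IsBounded U) {v : Plane → ℝ} {g : Plane → Plane} (h : MemH1 U v g)
    (h0 : ∫ x in U, v x = 0) :
    volume U * normL2 U v ^ 2 ≤ volume (U - U) * (Metric.ediam U * normL2 U g) ^ 2 := by
  wlog hv : Measurable v generalizing v
  · have hae := h.1.1.ae_eq_mk
    have := this (h.congr hae) (by rw [← integral_congr_ae hae, h0])
      h.1.1.stronglyMeasurable_mk.measurable
    rwa [normL2, ← eLpNorm_congr_ae hae] at this
  have hfin : IsFiniteMeasure (volume.restrict U) :=
    isFiniteMeasure_restrict.2 hUb.measure_lt_top.ne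
  have hF : Measurable (Function.uncurry fun x y => ‖v y - v x‖ₑ ^ 2) :=
    (((hv.comp measurable_snd).sub (hv.comp measurable_fst)).enorm.pow_const 2)
  calc volume U * normL2 U v ^ 2 = ∫⁻ x in U, normL2 U v ^ 2 := by
        rw [setLIntegral_const, mul_comm]
    _ ≤ ∫⁻ x in U, ∫⁻ y in U, ‖v y - v x‖ₑ ^ 2 := by
        refine lintegral_mono fun x => ?_
        rw [← eLpNorm_two_sq]
        exact pow_le_pow_left' (eLpNorm_le_eLpNorm_sub_const h.1 h0 (v x)) 2
    _ = ∫⁻ w, ∫⁻ x in U ∩ (fun x => x + w) ⁻¹' U, ‖v (x + w) - v x‖ₑ ^ 2 :=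
        setLIntegral_setLIntegral_eq_translate hUo.measurableSet hF
    _ ≤ ∫⁻ w, (U - U).indicator (fun _ => (Metric.ediam U * normL2 U g) ^ 2) w := by
        refine lintegral_mono fun w => ?_
        by_cases hw : w ∈ U - U
        · rw [Set.indicator_of_mem hw, ← eLpNorm_two_sq]
          refine pow_le_pow_left' ((h.normL2_translate_sub_le hUo hU hUb w).trans ?_) 2
          gcongr
          obtain ⟨x, hx, y, hy, rfl⟩ := hw
          rw [← edist_eq_enorm_sub]
          exact Metric.edist_le_ediam_of_mem hx hy
        · have : U ∩ (fun x => x + w) ⁻¹' U = ∅ := by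
            refine Set.eq_empty_of_forall_notMem fun x hx => hw ⟨x + w, hx.2, x, hx.1, ?_⟩
            simp
          rw [this, Measure.restrict_empty, lintegral_zero_measure]
          exact zero_le
    _ = volume (U - U) * (Metric.ediam U * normL2 U g) ^ 2 := by
        rw [lintegral_indicator (hUo.sub_right).measurableSet, setLIntegral_const, mul_comm]

/-! ### Triangles -/

lemma convex_closedTriangle (K : Affine.Triangle ℝ Plane) : Convex ℝ (closedTriangle K) :=
  convex_convexHull ℝ _

lemma isCompact_closedTriangle (K : Affine.Triangle ℝ Plane) : IsCompact (closedTriangle K) :=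
  (Set.finite_range K.points).isCompact_convexHull ℝ

lemma isBounded_interior_closedTriangle (K : Affine.Triangle ℝ Plane) :
    Bornology.IsBounded (interior (closedTriangle K)) :=
  (isCompact_closedTriangle K).isBounded.subset interior_subset

lemma interior_closedTriangle_nonempty (K : Affine.Triangle ℝ Plane) :
    (interior (closedTriangle K)).Nonempty := by
  rw [closedTriangle, interior_convexHull_nonempty_iff_affineSpan_eq_top,
    K.independent.affineSpan_eq_top_iff_card_eq_finrank_add_one]
  simp

lemma interior_closedTriangle_ae_eq (K : Affine.Triangle ℝ Plane) :
    interior (closedTriangle K) =ᵐ[volume] closedTriangle K :=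
  interior_ae_eq_of_null_frontier ((convex_closedTriangle K).addHaar_frontier volume)

lemma triangleDiam_ne_top (K : Affine.Triangle ℝ Plane) : triangleDiam K ≠ ⊤ :=
  (isCompact_closedTriangle K).isBounded.ediam_ne_top

lemma mem_closedTriangle_iff (K : Affine.Triangle ℝ Plane) (x : Plane) :
    x ∈ closedTriangle K ↔
      ∃ l : Fin 3 → ℝ, (∀ i, 0 ≤ l i) ∧ ∑ i, l i = 1 ∧ ∑ i, l i • K.points i = x := by
  constructor
  · rw [closedTriangle, convexHull_range_eq_exists_affineCombination]
    rintro ⟨s, w, hw0, hw1, rfl⟩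
    refine ⟨fun i => if i ∈ s then w i else 0, fun i => ?_, ?_, ?_⟩
    · dsimp only
      split_ifs with hi
      exacts [hw0 i hi, le_rfl]
    · rw [Finset.sum_ite_mem, Finset.univ_inter, hw1]
    · rw [Finset.affineCombination_eq_linear_combination _ _ _ hw1]
      simp_rw [ite_smul, zero_smul]
      rw [Finset.sum_ite_mem, Finset.univ_inter]
  · rintro ⟨l, hl0, hl1, rfl⟩
    exact mem_convexHull_of_exists_fintype l K.points hl0 hl1 (fun i => Set.mem_range_self i) rfl

/-- Reflecting a triangle in its centroid and doubling it gives a triangle that contains the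
original one; hence `K - K` lies in a translate of `3 K`. -/
lemma volume_closedTriangle_sub_le (K : Affine.Triangle ℝ Plane) :
    volume (closedTriangle K - closedTriangle K) ≤ 9 * volume (closedTriangle K) := by
  have hsub : closedTriangle K - closedTriangle K ⊆
      (fun x => x + ∑ i : Fin 3, K.points i) ⁻¹' ((3 : ℝ) • closedTriangle K) := by
    rintro _ ⟨x, hx, y, hy, rfl⟩
    obtain ⟨l, hl0, hl1, rfl⟩ := (mem_closedTriangle_iff K y).1 hy
    -- `y + 2 q` is the sum of the vertices.
    have hq : ∑ i, ((1 - l i) / 2) • K.points i ∈ closedTriangle K := by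
      refine (mem_closedTriangle_iff K _).2 ⟨_, fun i => ?_, ?_, rfl⟩
      · have := Finset.single_le_sum (fun i _ => hl0 i) (Finset.mem_univ i)
        rw [hl1] at this
        linarith
      · rw [← Finset.sum_div, Finset.sum_sub_distrib, hl1]
        norm_num
    refine ⟨_, convex_closedTriangle K hx hq (a := 1 / 3) (b := 2 / 3) (by norm_num) (by norm_num)
      (by norm_num), ?_⟩
    simp only [Fin.sum_univ_three]
    module
  calc volume (closedTriangle K - closedTriangle K)
      ≤ volume ((fun x => x + ∑ i : Fin 3, K.points i) ⁻¹' ((3 : ℝ) • closedTriangle K)) :=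
        measure_mono hsub
    _ = 9 * volume (closedTriangle K) := by
        rw [measure_preimage_add_right, Measure.addHaar_smul]
        norm_num

/-- The Poincaré constant of a triangle is at most three times its diameter. -/
lemma meanZeroQuotient_le (K : Affine.Triangle ℝ Plane) :
    meanZeroQuotient K ≤ ENNReal.ofReal 3 * triangleDiam K := by
  set U := interior (closedTriangle K) with hU
  refine iSup_le fun v => iSup_le fun g => iSup_le fun h => iSup_le fun h0 => ?_
  refine ENNReal.div_le_of_le_mul ?_
  have hpos : volume U ≠ 0 :=
    (isOpen_interior.measure_pos volume (interior_closedTriangle_nonempty K)).ne'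
  have hfin : volume U ≠ ⊤ := (isBounded_interior_closedTriangle K).measure_lt_top.ne
  have hp := h.poincare_of_convex isOpen_interior (convex_closedTriangle K).interior
    (isBounded_interior_closedTriangle K) h0
  have hUU : volume (U - U) ≤ volume U * 9 := by
    rw [measure_congr (interior_closedTriangle_ae_eq K), mul_comm]
    exact (measure_mono (Set.sub_subset_sub interior_subset interior_subset)).trans
      (volume_closedTriangle_sub_le K)
  have hd : Metric.ediam U ≤ triangleDiam K := Metric.ediam_mono interior_subset
  rw [← ENNReal.pow_le_pow_left_iff two_ne_zero, ← ENNReal.mul_le_mul_iff_right hpos hfin]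
  calc volume U * normL2 U v ^ 2 ≤ volume (U - U) * (Metric.ediam U * normL2 U g) ^ 2 := hp
    _ ≤ volume U * 9 * (triangleDiam K * normL2 U g) ^ 2 := by gcongr
    _ = volume U * (ENNReal.ofReal 3 * triangleDiam K * normL2 U g) ^ 2 := by
      have : ENNReal.ofReal 3 = 3 := by norm_num
      rw [this]
      ring

lemma isTriangleConstant_three : IsTriangleConstant 3 :=
  ⟨by norm_num, meanZeroQuotient_le⟩

/-! ### Operations on weak gradients -/

lemma gradient_apply_eq (ψ : Plane → ℝ) (x : Plane) (i : Fin 2) :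
    gradient ψ x i = fderiv ℝ ψ x (EuclideanSpace.single i 1) := by
  rw [← inner_gradient_left, EuclideanSpace.inner_single_right]
  simp

/-- Smooth functions on the plane have weak derivatives on every set, open or not. -/
lemma IsTestFunction.integral_fderiv_mul {U : Set Plane} {η : Plane → ℝ} (hη : IsTestFunction U η)
    {ψ : Plane → ℝ} (hψ : ContDiff ℝ ∞ ψ) (w : Plane) :
    ∫ x in U, ψ x * fderiv ℝ η x w = - ∫ x in U, fderiv ℝ ψ x w * η x := by
  have hη0 : ∀ x ∉ U, fderiv ℝ η x w = 0 := fun x hx => by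
    rw [fderiv_of_notMem_tsupport ℝ fun h => hx (hη.2.2 h)]
    rfl
  rw [setIntegral_eq_integral_of_forall_compl_eq_zero fun x hx => by rw [hη0 x hx, mul_zero],
    setIntegral_eq_integral_of_forall_compl_eq_zero fun x hx => by rw [hη.eq_zero hx, mul_zero]]
  have hψ' : Continuous (fun x => fderiv ℝ ψ x w) :=
    (hψ.continuous_fderiv (by simp)).clm_apply continuous_const
  have hη' : Continuous (fun x => fderiv ℝ η x w) :=
    (hη.1.continuous_fderiv (by simp)).clm_apply continuous_const
  refine integral_mul_fderiv_eq_neg_fderiv_mul_of_integrable ?_ ?_ ?_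
    (fun x _ => hψ.differentiable (by simp) x) (fun x _ => hη.1.differentiable (by simp) x)
  · exact (hψ'.mul hη.1.continuous).integrable_of_hasCompactSupport hη.2.1.mul_left
  · exact (hψ.continuous.mul hη').integrable_of_hasCompactSupport
      (hη.2.1.fderiv_apply ℝ w).mul_left
  · exact (hψ.continuous.mul hη.1.continuous).integrable_of_hasCompactSupport hη.2.1.mul_left

lemma MemH1.sub_const {U : Set Plane} (hUb : Bornology.IsBounded U) {v : Plane → ℝ}
    {g : Plane → Plane} (h : MemH1 U v g) (c : ℝ) : MemH1 U (fun x => v x - c) g := by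
  have hfin : IsFiniteMeasure (volume.restrict U) :=
    isFiniteMeasure_restrict.2 hUb.measure_lt_top.ne
  have hc : MemLp (fun _ : Plane => c) 2 (volume.restrict U) := memLp_const c
  refine ⟨h.1.sub hc, h.2.1, fun ψ hψ i => ?_⟩
  have h0 := hψ.integral_fderiv_mul (ψ := fun _ => c) contDiff_const (EuclideanSpace.single i 1)
  simp only [fderiv_fun_const, Pi.zero_apply, _root_.zero_apply, zero_mul,
    integral_zero, neg_zero] at h0
  simp_rw [sub_mul]
  rw [integral_sub (integrable_mul_of_memLp h.1 (hψ.memLp_fderiv _ _))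
    (integrable_mul_of_memLp hc (hψ.memLp_fderiv _ _)), h0, sub_zero, h.2.2 ψ hψ i]

/-- A function in `H¹₀(Ω)` belongs to `H¹(U)` for every set `U` that is contained in `Ω` up to a
null set. The difference `U \ Ω` does no harm, even if it is a slit inside `U`: the approximating
test functions are smooth on the whole plane. -/
lemma MemH10.memH1_of_ae_le {Ω U : Set Plane} (hU : U ≤ᵐ[volume] Ω) {φ : Plane → ℝ}
    {g : Plane → Plane} (h : MemH10 Ω φ g) : MemH1 U φ g := by
  have hle : volume.restrict U ≤ volume.restrict Ω := Measure.restrict_mono_ae hU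
  have hφ : MemL2 U φ := h.1.1.mono_measure hle
  have hg : MemL2 U g := h.1.2.1.mono_measure hle
  refine ⟨hφ, hg, fun η hη i => ?_⟩
  set e : Plane := EuclideanSpace.single i 1 with he
  have hη' : MemLp (fun x => fderiv ℝ η x e) 2 (volume.restrict U) := hη.memLp_fderiv _ _
  have hηL : MemLp η 2 (volume.restrict U) := hη.memLp _
  set A := (∫ x in U, φ x * fderiv ℝ η x e) + ∫ x in U, g x i * η x with hA
  -- Subtract the identity for a test function `ψ` near `φ`, for which the defect `A` is zero.
  have key : ∀ ε : ℝ≥0∞, 0 < ε →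
      ‖A‖ₑ ≤ ε * normL2 U (fun x => fderiv ℝ η x e) + ε * normL2 U η := by
    intro ε hε
    obtain ⟨ψ, hψ, h1, h2⟩ := h.2 ε hε
    have hψL : MemLp ψ 2 (volume.restrict U) := hψ.memLp _
    have hψ' : MemLp (fun x => gradient ψ x i) 2 (volume.restrict U) := by
      simp_rw [gradient_apply_eq]
      exact hψ.memLp_fderiv _ _
    have hgrad : MemLp (fun x => g x i - gradient ψ x i) 2 (volume.restrict U) :=
      (hg.apply i).sub hψ'
    have h1' : normL2 U (fun x => φ x - ψ x) ≤ ε :=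
      (eLpNorm_mono_measure _ hle).trans h1.le
    have h2' : normL2 U (fun x => g x i - gradient ψ x i) ≤ ε := by
      refine le_trans (eLpNorm_mono fun x => ?_) ((eLpNorm_mono_measure _ hle).trans h2.le)
      exact PiLp.norm_apply_le (g x - gradient ψ x) i
    have hparts := hη.integral_fderiv_mul hψ.1 e
    have hA' : A = (∫ x in U, (φ x - ψ x) * fderiv ℝ η x e) +
        ∫ x in U, (g x i - gradient ψ x i) * η x := by
      simp_rw [sub_mul]
      rw [integral_sub (integrable_mul_of_memLp hφ hη') (integrable_mul_of_memLp hψL hη'),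
        integral_sub (integrable_mul_of_memLp (hg.apply i) hηL) (integrable_mul_of_memLp hψ' hηL),
        hparts]
      simp_rw [gradient_apply_eq]
      rw [hA]
      ring
    rw [hA']
    refine (enorm_add_le _ _).trans (add_le_add ?_ ?_)
    · exact (enorm_integral_mul_le (hφ.sub hψL).1 hη'.1).trans (mul_le_mul_left h1' _)
    · exact (enorm_integral_mul_le hgrad.1 hηL.1).trans (mul_le_mul_left h2' _)
  have hA0 : A = 0 := by
    have hlim : Filter.Tendsto
        (fun ε : ℝ≥0∞ => ε * normL2 U (fun x => fderiv ℝ η x e) + ε * normL2 U η)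
        (nhdsWithin 0 (Set.Ioi 0)) (nhds (0 * normL2 U (fun x => fderiv ℝ η x e) +
          0 * normL2 U η)) := by
      have hid : Filter.Tendsto (fun ε : ℝ≥0∞ => ε) (nhdsWithin 0 (Set.Ioi 0)) (nhds 0) :=
        nhdsWithin_le_nhds
      exact (ENNReal.Tendsto.mul_const hid (Or.inr hη'.eLpNorm_ne_top)).add
        (ENNReal.Tendsto.mul_const hid (Or.inr hηL.eLpNorm_ne_top))
    have : ‖A‖ₑ ≤ 0 := by
      refine (ge_of_tendsto hlim ?_).trans (by simp)
      filter_upwards [self_mem_nhdsWithin] with ε hε using key ε hε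
    simpa using this
  linarith

/-! ### Triangulations -/

lemma volume_segment_eq_zero (p q : Plane) : volume (segment ℝ p q) = 0 := by
  rw [← convexHull_pair]
  refine measure_mono_null (convexHull_subset_affineSpan _)
    (Measure.addHaar_affineSubspace volume _ fun htop => ?_)
  have hv : vectorSpan ℝ {p, q} = ⊤ :=
    AffineSubspace.vectorSpan_eq_top_of_affineSpan_eq_top _ _ _ htop
  have hc : Module.finrank ℝ (vectorSpan ℝ ({p, q} : Set Plane)) ≤ 1 :=
    (collinear_iff_finrank_le_one).1 (collinear_pair ℝ p q)
  rw [hv, finrank_top, finrank_euclideanSpace_fin] at hc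
  norm_num at hc

lemma IsPolygonalDomain.ae_eq_closure {Ω : Set Plane} (h : IsPolygonalDomain Ω) :
    Ω =ᵐ[volume] closure Ω := by
  obtain ⟨ho, -, -, S, hS⟩ := h
  have h0 : volume (frontier Ω) = 0 := by
    rw [hS]
    exact (measure_biUnion_null_iff S.countable_toSet).2 fun p _ => volume_segment_eq_zero _ _
  exact (closure_ae_eq_of_null_frontier h0).symm

lemma IsProperTriangulation.volume_inter_eq_zero {Ω : Set Plane}
    {T : Finset (Affine.Triangle ℝ Plane)} (hT : IsProperTriangulation Ω T)
    {K₁ K₂ : Affine.Triangle ℝ Plane} (h₁ : K₁ ∈ T) (h₂ : K₂ ∈ T) (hne : K₁ ≠ K₂) :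
    volume (closedTriangle K₁ ∩ closedTriangle K₂) = 0 := by
  rcases hT.2 K₁ h₁ K₂ h₂ hne with h | ⟨i, j, -, h⟩ | ⟨e, ⟨i, j, -, rfl⟩, -, h⟩
  · rw [h, measure_empty]
  · rw [h, measure_singleton]
  · rw [h, volume_segment_eq_zero]

lemma IsProperTriangulation.pairwiseDisjoint {Ω : Set Plane}
    {T : Finset (Affine.Triangle ℝ Plane)} (hT : IsProperTriangulation Ω T) :
    (T : Set (Affine.Triangle ℝ Plane)).PairwiseDisjoint
      (fun K => interior (closedTriangle K)) := by
  intro K₁ h₁ K₂ h₂ hne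
  rw [Function.onFun, Set.disjoint_iff_inter_eq_empty]
  exact (isOpen_interior.inter isOpen_interior).eq_empty_of_measure_zero (μ := volume)
    (measure_mono_null (Set.inter_subset_inter interior_subset interior_subset)
      (hT.volume_inter_eq_zero h₁ h₂ hne))

lemma IsProperTriangulation.ae_eq_biUnion_interior {Ω : Set Plane}
    {T : Finset (Affine.Triangle ℝ Plane)} (hΩ : IsPolygonalDomain Ω)
    (hT : IsProperTriangulation Ω T) :
    Ω =ᵐ[volume] ⋃ K ∈ T, interior (closedTriangle K) := by
  refine hΩ.ae_eq_closure.trans ?_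
  rw [hT.1]
  exact Filter.EventuallyEq.biUnion T.finite_toSet fun K _ => (interior_closedTriangle_ae_eq K).symm

lemma IsProperTriangulation.interior_ae_le {Ω : Set Plane}
    {T : Finset (Affine.Triangle ℝ Plane)} (hΩ : IsPolygonalDomain Ω)
    (hT : IsProperTriangulation Ω T) {K : Affine.Triangle ℝ Plane} (hK : K ∈ T) :
    interior (closedTriangle K) ≤ᵐ[volume] Ω := by
  have h : interior (closedTriangle K) ⊆ ⋃ K ∈ T, interior (closedTriangle K) :=
    Set.subset_biUnion_of_mem (u := fun K => interior (closedTriangle K)) hK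
  exact h.eventuallyLE.trans (hT.ae_eq_biUnion_interior hΩ).symm.le

lemma IsProperTriangulation.normL2_sq {F : Type*} [NormedAddCommGroup F] {Ω : Set Plane}
    {T : Finset (Affine.Triangle ℝ Plane)} (hΩ : IsPolygonalDomain Ω)
    (hT : IsProperTriangulation Ω T) (u : Plane → F) :
    normL2 Ω u ^ 2 = ∑ K ∈ T, normL2 (interior (closedTriangle K)) u ^ 2 := by
  simp_rw [normL2, eLpNorm_two_sq]
  rw [Measure.restrict_congr_set (hT.ae_eq_biUnion_interior hΩ),
    lintegral_biUnion_finset hT.pairwiseDisjoint fun K _ => isOpen_interior.measurableSet]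

lemma IsProperTriangulation.setIntegral_eq_sum {Ω : Set Plane}
    {T : Finset (Affine.Triangle ℝ Plane)} (hΩ : IsPolygonalDomain Ω)
    (hT : IsProperTriangulation Ω T) {u : Plane → ℝ}
    (hu : ∀ K ∈ T, IntegrableOn u (interior (closedTriangle K))) :
    ∫ x in Ω, u x = ∑ K ∈ T, ∫ x in interior (closedTriangle K), u x := by
  rw [Measure.restrict_congr_set (hT.ae_eq_biUnion_interior hΩ)]
  exact integral_biUnion_finset T (fun K _ => isOpen_interior.measurableSet) hT.pairwiseDisjoint hu

lemma IsProperTriangulation.piecewiseMean_eq {Ω : Set Plane}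
    {T : Finset (Affine.Triangle ℝ Plane)} (hT : IsProperTriangulation Ω T) (f : Plane → ℝ)
    {K : Affine.Triangle ℝ Plane} (hK : K ∈ T) {x : Plane} (hx : x ∈ interior (closedTriangle K)) :
    piecewiseMean T f x = ⨍ y in interior (closedTriangle K), f y := by
  rw [piecewiseMean, Finset.sum_eq_single_of_mem K hK, Set.indicator_of_mem hx,
    setAverage_congr (interior_closedTriangle_ae_eq K)]
  intro K' hK' hne
  exact Set.indicator_of_notMem (fun hx' => (hT.pairwiseDisjoint hK' hK hne).le_bot ⟨hx', hx⟩) _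

lemma measurable_piecewiseMean (T : Finset (Affine.Triangle ℝ Plane)) (f : Plane → ℝ) :
    Measurable (piecewiseMean T f) :=
  Finset.measurable_fun_sum _ fun _ _ =>
    measurable_const.indicator isOpen_interior.measurableSet

/-! ### The error of the piecewise mean value -/

/-- Subtracting the mean value is symmetric with respect to the pairing of `L²(U)`. -/
lemma setIntegral_sub_setAverage_mul {U : Set Plane} [IsFiniteMeasure (volume.restrict U)]
    {f φ : Plane → ℝ} (hf : MemL2 U f) (hφ : MemL2 U φ) :
    ∫ x in U, (f x - ⨍ y in U, f y) * φ x = ∫ x in U, f x * (φ x - ⨍ y in U, φ y) := by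
  have hf1 : Integrable f (volume.restrict U) := hf.integrable (by norm_num)
  have hφ1 : Integrable φ (volume.restrict U) := hφ.integrable (by norm_num)
  simp_rw [sub_mul, mul_sub]
  rw [integral_sub (integrable_mul_of_memLp hf hφ) (hφ1.const_mul _),
    integral_sub (integrable_mul_of_memLp hf hφ) (hf1.mul_const _), integral_const_mul,
    integral_mul_const, average_eq, average_eq, smul_eq_mul, smul_eq_mul]
  ring

lemma IsTriangleConstant.normL2_sub_setAverage_le {C : ℝ} (hC : IsTriangleConstant C)
    (K : Affine.Triangle ℝ Plane) {v : Plane → ℝ} {g : Plane → Plane}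
    (h : MemH1 (interior (closedTriangle K)) v g) :
    normL2 (interior (closedTriangle K)) (fun x => v x - ⨍ y in interior (closedTriangle K), v y) ≤
      ENNReal.ofReal C * triangleDiam K * normL2 (interior (closedTriangle K)) g := by
  set U := interior (closedTriangle K) with hU
  have hUb : Bornology.IsBounded U := isBounded_interior_closedTriangle K
  have hfin : IsFiniteMeasure (volume.restrict U) :=
    isFiniteMeasure_restrict.2 hUb.measure_lt_top.ne
  have hCK : ENNReal.ofReal C * triangleDiam K ≠ ⊤ :=
    ENNReal.mul_ne_top ENNReal.ofReal_ne_top (triangleDiam_ne_top K)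
  -- The bound is finite, so `|v|_K / |∇v|_K ≤ C h_K` also covers the case `∇v = 0`.
  refine (ENNReal.div_le_iff_le_mul (Or.inr hCK) (Or.inl h.2.1.eLpNorm_ne_top)).1 ?_
  refine le_trans ?_ (hC.2 K)
  exact le_iSup_of_le _ (le_iSup_of_le g (le_iSup_of_le (h.sub_const hUb _)
    (le_iSup_of_le (integral_sub_average _ _) le_rfl)))

lemma IsTriangleConstant.normL2_sub_piecewiseMean_le {C : ℝ} (hC : IsTriangleConstant C)
    {Ω : Set Plane} {T : Finset (Affine.Triangle ℝ Plane)} (hΩ : IsPolygonalDomain Ω)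
    (hT : IsProperTriangulation Ω T) {φ : Plane → ℝ} {g : Plane → Plane} (h : MemH10 Ω φ g) :
    normL2 Ω (fun x => φ x - piecewiseMean T φ x) ≤
      ENNReal.ofReal C * meshSize T * normL2 Ω g := by
  rw [← ENNReal.pow_le_pow_left_iff two_ne_zero, mul_pow, hT.normL2_sq hΩ, hT.normL2_sq hΩ,
    Finset.mul_sum]
  refine Finset.sum_le_sum fun K hK => ?_
  have hle : triangleDiam K ≤ meshSize T := Finset.le_sup hK
  rw [← mul_pow]
  refine pow_le_pow_left' ?_ 2
  have heq : normL2 (interior (closedTriangle K)) (fun x => φ x - piecewiseMean T φ x) =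
      normL2 (interior (closedTriangle K))
        (fun x => φ x - ⨍ y in interior (closedTriangle K), φ y) := by
    refine eLpNorm_congr_ae ?_
    filter_upwards [ae_restrict_mem isOpen_interior.measurableSet] with x hx
    rw [hT.piecewiseMean_eq φ hK hx]
  rw [heq]
  refine (hC.normL2_sub_setAverage_le K (h.memH1_of_ae_le (hT.interior_ae_le hΩ hK))).trans ?_
  gcongr

/-- The projection onto the piecewise constant functions is symmetric in `L²(Ω)`. -/
lemma IsProperTriangulation.setIntegral_sub_piecewiseMean_mul {Ω : Set Plane}
    {T : Finset (Affine.Triangle ℝ Plane)} (hΩ : IsPolygonalDomain Ω)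
    (hT : IsProperTriangulation Ω T) {f φ : Plane → ℝ} (hf : MemL2 Ω f) (hφ : MemL2 Ω φ) :
    ∫ x in Ω, (f x - piecewiseMean T f x) * φ x =
      ∫ x in Ω, f x * (φ x - piecewiseMean T φ x) := by
  have hfin : ∀ K : Affine.Triangle ℝ Plane,
      IsFiniteMeasure (volume.restrict (interior (closedTriangle K))) := fun K =>
    isFiniteMeasure_restrict.2 (isBounded_interior_closedTriangle K).measure_lt_top.ne
  have hL2 : ∀ {u : Plane → ℝ}, MemL2 Ω u → ∀ K ∈ T, MemL2 (interior (closedTriangle K)) u :=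
    fun hu K hK => hu.mono_measure (Measure.restrict_mono_ae (hT.interior_ae_le hΩ hK))
  have hae : ∀ u : Plane → ℝ, ∀ K ∈ T,
      (fun x => u x - piecewiseMean T u x) =ᵐ[volume.restrict (interior (closedTriangle K))]
        fun x => u x - ⨍ y in interior (closedTriangle K), u y := by
    intro u K hK
    filter_upwards [ae_restrict_mem isOpen_interior.measurableSet] with x hx
    rw [hT.piecewiseMean_eq u hK hx]
  have hsub : ∀ {u : Plane → ℝ}, MemL2 Ω u → ∀ K ∈ T,
      MemL2 (interior (closedTriangle K)) (fun x => u x - piecewiseMean T u x) :=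
    fun hu K hK => ((hL2 hu K hK).sub (memLp_const _)).ae_eq (hae _ K hK).symm
  rw [hT.setIntegral_eq_sum hΩ fun K hK => integrable_mul_of_memLp (hsub hf K hK) (hL2 hφ K hK),
    hT.setIntegral_eq_sum hΩ fun K hK => integrable_mul_of_memLp (hL2 hf K hK) (hsub hφ K hK)]
  refine Finset.sum_congr rfl fun K hK => ?_
  calc ∫ x in interior (closedTriangle K), (f x - piecewiseMean T f x) * φ x
      = ∫ x in interior (closedTriangle K),
          (f x - ⨍ y in interior (closedTriangle K), f y) * φ x :=
        integral_congr_ae ((hae f K hK).mul (ae_eq_refl φ))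
    _ = ∫ x in interior (closedTriangle K),
          f x * (φ x - ⨍ y in interior (closedTriangle K), φ y) :=
        setIntegral_sub_setAverage_mul (hL2 hf K hK) (hL2 hφ K hK)
    _ = ∫ x in interior (closedTriangle K), f x * (φ x - piecewiseMean T φ x) :=
        integral_congr_ae ((ae_eq_refl f).mul (hae φ K hK).symm)

theorem mainTheorem7 :
    (∃ C : ℝ, IsTriangleConstant C) ∧
    ∀ C : ℝ, IsTriangleConstant C →
      ∀ (Ω : Set Plane) (T : Finset (Affine.Triangle ℝ Plane)),
        IsPolygonalDomain Ω → IsProperTriangulation Ω T →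
        ∀ f : Plane → ℝ, MemL2 Ω f →
          normHneg1 Ω (fun x => f x - piecewiseMean T f x) ≤
            ENNReal.ofReal C * meshSize T * normL2 Ω f := by
  refine ⟨⟨3, isTriangleConstant_three⟩, fun C hC Ω T hΩ hT f hf => ?_⟩
  refine iSup_le fun φ => iSup_le fun g => iSup_le fun h => ENNReal.div_le_of_le_mul ?_
  have hmeas : AEStronglyMeasurable (fun x => φ x - piecewiseMean T φ x) (volume.restrict Ω) :=
    h.1.1.1.sub (measurable_piecewiseMean T φ).aestronglyMeasurable
  calc ENNReal.ofReal (∫ x in Ω, (f x - piecewiseMean T f x) * φ x)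
      ≤ ‖∫ x in Ω, (f x - piecewiseMean T f x) * φ x‖ₑ := by
        rw [← ofReal_norm]
        exact ENNReal.ofReal_le_ofReal (Real.le_norm_self _)
    _ = ‖∫ x in Ω, f x * (φ x - piecewiseMean T φ x)‖ₑ := by
        rw [hT.setIntegral_sub_piecewiseMean_mul hΩ hf h.1.1]
    _ ≤ normL2 Ω f * normL2 Ω (fun x => φ x - piecewiseMean T φ x) :=
        enorm_integral_mul_le hf.1 hmeas
    _ ≤ normL2 Ω f * (ENNReal.ofReal C * meshSize T * normL2 Ω g) := by
        gcongr
        exact hC.normL2_sub_piecewiseMean_le hΩ hT h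
    _ = ENNReal.ofReal C * meshSize T * normL2 Ω f * normL2 Ω g := by ring
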